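/- Let $\Omega=\{0,1\}^{\infty}$ carry the product topology, and let $\Sigma$ be a $\sigma$-algebra on $\Omega$ that contains all cylinders (hence all open sets). An \emph{opinion} is a finitely additive probability $P$ on $(\Omega,\Sigma)$ that is strongly nonatomic: for every $E\in\Sigma$ and every $\alpha\in[0,1]$ there is $F\in\Sigma$ with $F\subseteq E$ and $P(F)=\alpha P(E)$. Let $\Delta$ be the set of all opinions. A \emph{test} is a function $T$ that assigns to each $P\in\Delta$ an open set $T(P)\subseteq\Omega$. Let $\varepsilon\in[0,1)$ and let $T$ be a test that $\Delta$-controls for type I error with probability $1-\varepsilon$, that is, $P(T(P))\le\varepsilon$ for every $P\in\Delta$. Then for every $\delta\in(0,1-\varepsilon]$ the test $T$ can be manipulated with probability $1-\varepsilon-\delta$, that is, there is a probability measure $\zeta$ on $\Delta$ with finite support such that for every $\omega\in\Omega$ $$\zeta\bigl(\{P\in\Delta:\omega\notin T(P)\}\bigr)\ \ge\ 1-\varepsilon-\delta .$$ -/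

import Mathlib

namespace OpinionTesting

open scoped MeasureTheory

/-- The set `Ω = {0,1}^∞` of all paths, with the product topology. -/
abbrev Paths : Type := ℕ → Fin 2

/-- A σ-algebra `Σ` of events on `Ω` that contains all cylinders
`ω^t = {ω' | ω' agrees with ω in the first t periods}`. -/
structure EventAlgebra where
  sigma : MeasurableSpace Paths
  cylinder_mem : ∀ (ω : Paths) (t : ℕ), MeasurableSet[sigma] (PiNat.cylinder ω t)

/-- The events, that is, the members of `Σ`. -/
abbrev Event (S : EventAlgebra) : Type := {E : Set Paths // MeasurableSet[S.sigma] E}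

/-- Every open set of paths is an event. -/
theorem EventAlgebra.measurableSet_of_isOpen (S : EventAlgebra) {U : Set Paths}
    (hU : IsOpen U) : MeasurableSet[S.sigma] U := by
  have hb := PiNat.isTopologicalBasis_cylinders (E := fun _ : ℕ => Fin 2)
  have hle : borel Paths ≤ S.sigma := by
    rw [hb.borel_eq_generateFrom]
    refine MeasurableSpace.generateFrom_le ?_
    rintro _ ⟨ω, t, rfl⟩
    exact S.cylinder_mem ω t
  exact hle _ (MeasurableSpace.measurableSet_generateFrom hU)

/-- An open set of paths, regarded as an event. -/
def openEvent (S : EventAlgebra) (U : TopologicalSpace.Opens Paths) : Event S :=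
  ⟨U, S.measurableSet_of_isOpen U.isOpen⟩

/-- A finitely additive probability on `(Ω, Σ)`. -/
@[ext]
structure FinAddProb (S : EventAlgebra) where
  prob : Event S → ℝ
  nonneg : ∀ E, 0 ≤ prob E
  prob_univ : prob ⟨Set.univ, @MeasurableSet.univ _ S.sigma⟩ = 1
  prob_union : ∀ E F : Event S, Disjoint E.1 F.1 →
    prob ⟨E.1 ∪ F.1, @MeasurableSet.union _ S.sigma _ _ E.2 F.2⟩ = prob E + prob F

/-- `P` is strongly nonatomic (Savagean). -/
def FinAddProb.StronglyNonatomic {S : EventAlgebra} (P : FinAddProb S) : Prop :=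
  ∀ (E : Event S) (α : ℝ), α ∈ Set.Icc (0 : ℝ) 1 →
    ∃ F : Event S, F.1 ⊆ E.1 ∧ P.prob F = α * P.prob E

/-- The set `Δ` of all opinions: strongly nonatomic finitely additive probabilities. -/
abbrev Opinion (S : EventAlgebra) : Type := {P : FinAddProb S // P.StronglyNonatomic}

/-- A test assigns to each opinion `P` an open set `T P` of paths on which `P` is rejected. -/
abbrev Test (S : EventAlgebra) : Type := Opinion S → TopologicalSpace.Opens Paths

/-- `T` `Λ`-controls for type I error with probability `1 - ε`. -/
def Test.ControlsTypeI {S : EventAlgebra} (T : Test S) (Λ : Set (Opinion S)) (ε : ℝ) : Prop :=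
  ∀ P ∈ Λ, P.1.prob (openEvent S (T P)) ≤ ε

/-- A strategy: a probability measure on the set of opinions with finite support. -/
abbrev Strategy (S : EventAlgebra) : Type := {ζ : PMF (Opinion S) // ζ.support.Finite}

/-- The probability `ζ(A)` of a set `A` of opinions. -/
noncomputable def Strategy.probOf {S : EventAlgebra} (ζ : Strategy S)
    (A : Set (Opinion S)) : ℝ :=
  (ζ.1.toOuterMeasure A).toReal

/-- `T` can be manipulated with probability `q`. -/
def Test.CanBeManipulated {S : EventAlgebra} (T : Test S) (q : ℝ) : Prop :=
  ∃ ζ : Strategy S, ∀ ω : Paths, q ≤ Strategy.probOf ζ {P | ω ∉ T P}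

end OpinionTesting

/-!
Suppose that no strategy manipulates the test with probability `1 - c`, where `c = ε + δ`. Then
every nonnegative combination of the functions `1_{T P} - c` is nonnegative at some path `ω`. Let
`truncate ω k` be the path that follows `ω` before `k`, has a `1` at `k`, and vanishes afterwards.
It tends to `ω`, so since the sets `T P` are open, the combination is eventually nonnegative along
the truncations of `ω`. Hence the cone spanned by the functions `1_{T P} - c` and by all bounded
functions whose partial sums along every truncation sequence are bounded below contains no negative
constant, and the Riesz extension theorem yields a normalised functional that is nonnegative on it.
On indicators this functional is a finitely additive probability giving every `T P` probability at
least `c`. It is strongly nonatomic, because the last `1` of `truncate ω k` is at `k`, so that the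
event "the last `1` is at a position congruent to `r` modulo `n`" has probability at most `1 / n`.
Evaluating the test at this opinion contradicts the control of the type I error.
-/

namespace OpinionTesting

open Filter Topology
open scoped NNReal ENNReal lp MeasureTheory

section PositiveFunctional

variable {E : Type*} [AddCommGroup E] [Module ℝ E]

theorem exists_linearMap_nonneg_of_orderUnit (K : PointedCone ℝ E) (e : E)
    (hunit : ∀ y, ∃ r : ℝ, r • e + y ∈ K) (hK : ∀ a : ℝ, a • e ∈ K → 0 ≤ a) :
    ∃ g : E →ₗ[ℝ] ℝ, g e = 1 ∧ ∀ x ∈ K, 0 ≤ g x := by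
  have he : e ≠ 0 := by
    rintro rfl
    linarith [hK (-1) (by simp)]
  let f : E →ₗ.[ℝ] ℝ := LinearPMap.mkSpanSingleton e 1 he
  have hf (a : ℝ) (h : a • e ∈ f.domain) : f ⟨a • e, h⟩ = a :=
    (LinearPMap.mkSpanSingleton'_apply ..).trans (mul_one a)
  have mem_domain (a : ℝ) : a • e ∈ f.domain := Submodule.mem_span_singleton.2 ⟨a, rfl⟩
  obtain ⟨g, hgf, hg⟩ := riesz_extension K f
    (by
      rintro ⟨x, hx⟩ hxK
      obtain ⟨a, rfl⟩ := Submodule.mem_span_singleton.1 hx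
      exact (hK a hxK).trans_eq (hf a hx).symm)
    (fun y => (hunit y).imp' (fun r => ⟨r • e, mem_domain r⟩) fun _ h => h)
  refine ⟨g, ?_, hg⟩
  simpa using (hgf ⟨_, mem_domain 1⟩).trans (hf 1 _)

end PositiveFunctional

section PartialSums

variable {X : Type*}

/-- The indicator function of a set, as a bounded function. -/
noncomputable def boundedIndicator (A : Set X) : ℓ^∞(X, ℝ) :=
  ⟨A.indicator 1, memℓp_infty ⟨1, Set.forall_mem_range.2 fun x => by
    by_cases hx : x ∈ A <;> simp [hx]⟩⟩

@[simp]
theorem boundedIndicator_apply (A : Set X) (x : X) :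
    boundedIndicator A x = A.indicator (1 : X → ℝ) x :=
  rfl

theorem boundedIndicator_univ : boundedIndicator (Set.univ : Set X) = 1 :=
  lp.ext (Set.indicator_univ _)

theorem boundedIndicator_union {A B : Set X} (h : Disjoint A B) :
    boundedIndicator (A ∪ B) = boundedIndicator A + boundedIndicator B :=
  Subtype.ext (Set.indicator_union_of_disjoint h 1)

/-- The cone of bounded functions whose partial sums along the sequence `x` are bounded below.
Positivity on it is a form of positivity along the Cesàro means of `x` that involves no limits. -/
def partialSumCone (x : ℕ → X) : PointedCone ℝ ℓ^∞(X, ℝ) where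
  carrier := {f | BddBelow (Set.range fun N => ∑ k ∈ Finset.range N, f (x k))}
  zero_mem' := ⟨0, by rintro _ ⟨N, rfl⟩; simp⟩
  add_mem' := by
    rintro f g ⟨a, ha⟩ ⟨b, hb⟩
    refine ⟨a + b, ?_⟩
    rintro _ ⟨N, rfl⟩
    simpa [Finset.sum_add_distrib] using add_le_add (ha ⟨N, rfl⟩) (hb ⟨N, rfl⟩)
  smul_mem' := by
    rintro ⟨r, hr⟩ f ⟨a, ha⟩
    refine ⟨r * a, ?_⟩
    rintro _ ⟨N, rfl⟩
    exact (mul_le_mul_of_nonneg_left (ha ⟨N, rfl⟩) hr).trans_eq (Finset.mul_sum ..)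

theorem mem_partialSumCone_of_eventually_nonneg {x : ℕ → X} {f : ℓ^∞(X, ℝ)}
    (h : ∀ᶠ k in atTop, 0 ≤ f (x k)) : f ∈ partialSumCone x := by
  obtain ⟨n, hn⟩ := eventually_atTop.1 h
  refine IsBoundedUnder.bddBelow_range ⟨∑ k ∈ Finset.range n, f (x k), eventually_map.2 ?_⟩
  filter_upwards [eventually_ge_atTop n] with N hN
  exact Finset.sum_le_sum_of_subset_of_nonneg (Finset.range_subset_range.2 hN)
    fun k _ hk => hn k (by simpa using hk)

theorem eventually_indicator_one_le [TopologicalSpace X] {U : Set X} (hU : IsOpen U) (p : X) :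
    ∀ᶠ y in 𝓝 p, U.indicator (1 : X → ℝ) p ≤ U.indicator (1 : X → ℝ) y := by
  by_cases hp : p ∈ U
  · filter_upwards [hU.mem_nhds hp] with y hy
    simp [hp, hy]
  · refine .of_forall fun y => ?_
    rw [Set.indicator_of_notMem hp]
    exact Set.indicator_nonneg (fun _ _ => zero_le_one) y

theorem sum_boundedIndicator_sub_mem_partialSumCone [TopologicalSpace X] {x : ℕ → X} {p : X}
    (hx : Tendsto x atTop (𝓝 p)) {ι : Type*} {U : ι → TopologicalSpace.Opens X} {c : ℝ}
    {w : ι →₀ ℝ≥0}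
    (hw : 0 ≤ w.sum fun i a => (a : ℝ) * ((U i : Set X).indicator (1 : X → ℝ) p - c)) :
    (w.sum fun i a => a • (boundedIndicator (U i : Set X) - c • 1)) ∈ partialSumCone x := by
  refine mem_partialSumCone_of_eventually_nonneg ?_
  have hev : ∀ᶠ k in atTop, ∀ i ∈ w.support,
      (U i : Set X).indicator (1 : X → ℝ) p ≤ (U i : Set X).indicator (1 : X → ℝ) (x k) :=
    (Finset.eventually_all _).2 fun i _ =>
      hx.eventually (eventually_indicator_one_le (U i).isOpen p)
  filter_upwards [hev] with k hk
  calc 0 ≤ w.sum fun i a => (a : ℝ) * ((U i : Set X).indicator (1 : X → ℝ) p - c) := hw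
    _ ≤ w.sum fun i a => (a : ℝ) * ((U i : Set X).indicator (1 : X → ℝ) (x k) - c) :=
      Finset.sum_le_sum fun i hi =>
        mul_le_mul_of_nonneg_left (sub_le_sub_right (hk i hi) c) (w i).2
    _ = _ := by
      simp only [Finsupp.sum, lp.coeFn_sum, NNReal.smul_def, lp.coeFn_smul, lp.coeFn_sub,
        lp.infty_coeFn_one, Finset.sum_apply, Pi.smul_apply, Pi.sub_apply, Pi.one_apply,
        boundedIndicator_apply, smul_eq_mul, mul_one]

theorem nonneg_of_smul_one_mem_partialSumCone {x : ℕ → X} {a : ℝ}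
    (h : a • (1 : ℓ^∞(X, ℝ)) ∈ partialSumCone x) : 0 ≤ a := by
  obtain ⟨b, hb⟩ := h
  by_contra! ha
  obtain ⟨N, hN⟩ := Archimedean.arch (1 - b) (neg_pos.2 ha)
  have hbN : b ≤ N * a := by simpa [lp.infty_coeFn_one] using hb ⟨N, rfl⟩
  rw [nsmul_eq_mul] at hN
  linarith

theorem inv_smul_one_sub_boundedIndicator_mem_partialSumCone {x : ℕ → X} {A : Set X} {n r : ℕ}
    (hn : 0 < n) (hA : ∀ k, x k ∈ A ↔ k ≡ r [MOD n]) :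
    (n : ℝ)⁻¹ • (1 : ℓ^∞(X, ℝ)) - boundedIndicator A ∈ partialSumCone x := by
  classical
  refine ⟨-1, ?_⟩
  rintro _ ⟨N, rfl⟩
  have hcount : ∑ k ∈ Finset.range N, A.indicator (1 : X → ℝ) (x k) = N.count (· ≡ r [MOD n]) := by
    simp [Set.indicator_apply, hA, Nat.count_eq_card_filter_range]
  have hle : (N.count (· ≡ r [MOD n]) : ℝ) ≤ N / n + 1 := by
    have hcount_le : N.count (· ≡ r [MOD n]) ≤ N / n + 1 := by
      rw [Nat.count_modEq_card _ hn]
      split_ifs <;> lia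
    grw [hcount_le]
    push_cast
    grw [Nat.cast_div_le]
  have hsum : ∑ k ∈ Finset.range N, ((n : ℝ)⁻¹ • (1 : ℓ^∞(X, ℝ)) - boundedIndicator A) (x k)
      = N / n - N.count (· ≡ r [MOD n]) := by
    simp only [lp.coeFn_sub, lp.coeFn_smul, lp.infty_coeFn_one, Pi.sub_apply, Pi.smul_apply,
      Pi.one_apply, boundedIndicator_apply, smul_eq_mul, mul_one, Finset.sum_sub_distrib, hcount,
      Finset.sum_const, Finset.card_range, nsmul_eq_mul, div_eq_mul_inv]
  linarith

end PartialSums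

namespace FinAddProb

variable {S : EventAlgebra} (P : FinAddProb S)

theorem prob_sup_eq_add_sdiff (A B : Event S) :
    P.prob (A ⊔ B) = P.prob A + P.prob (B \ A) := by
  rw [← sup_sdiff_self_right]
  exact P.prob_union A (B \ A) Set.disjoint_sdiff_right

theorem prob_mono {A B : Event S} (h : A ≤ B) : P.prob A ≤ P.prob B := by
  have hadd := P.prob_sup_eq_add_sdiff A B
  rw [sup_eq_right.2 h] at hadd
  linarith [P.nonneg (B \ A)]

theorem prob_sup_le (A B : Event S) : P.prob (A ⊔ B) ≤ P.prob A + P.prob B := by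
  grw [prob_sup_eq_add_sdiff, P.prob_mono (sdiff_le : B \ A ≤ B)]

theorem prob_bot : P.prob ⊥ = 0 := by
  simpa using P.prob_sup_eq_add_sdiff ⊥ ⊥

/-- For every `η > 0`, finitely many events of probability at most `η` cover the space; a criterion
for strong nonatomicity. -/
def HasSmallCovers : Prop :=
  ∀ η : ℝ, 0 < η → ∃ s : Finset (Event S), s.sup id = ⊤ ∧ ∀ E ∈ s, P.prob E ≤ η

variable {P}

/-- Add the members of `s` to the lower end one at a time until its probability passes `c`. -/
theorem exists_interval_le_of_le_sup {s : Finset (Event S)} {η c : ℝ} (hη : 0 ≤ η)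
    (hs : ∀ E ∈ s, P.prob E ≤ η) (I : NonemptyInterval (Event S))
    (hI : I.snd ≤ I.fst ⊔ s.sup id) (hc : c ∈ Set.Icc (P.prob I.fst) (P.prob I.snd)) :
    ∃ J ≤ I, c ∈ Set.Icc (P.prob J.fst) (P.prob J.snd) ∧ P.prob J.snd ≤ P.prob J.fst + η := by
  classical
  induction s using Finset.induction_on generalizing I with
  | empty =>
    refine ⟨I, le_rfl, hc, ?_⟩
    have hle : P.prob I.snd ≤ P.prob I.fst := P.prob_mono (by simpa using hI)
    linarith
  | insert E s _ ih =>
    obtain ⟨hE, hs⟩ := Finset.forall_mem_insert .. |>.1 hs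
    let A : Event S := I.fst ⊔ E ⊓ I.snd
    have hA : A ≤ I.snd := sup_le I.fst_le_snd inf_le_right
    have hIA : I.fst ≤ A := le_sup_left
    rcases le_total (P.prob A) c with hAc | hcA
    · obtain ⟨J, hJ, h⟩ := ih hs ⟨(A, I.snd), hA⟩
        (by
          rw [Finset.sup_insert, id, ← sup_assoc] at hI
          simp only [A, sup_inf_left, sup_inf_right]
          exact le_inf hI (le_sup_right.trans le_sup_left)) ⟨hAc, hc.2⟩
      exact ⟨J, ⟨hIA.trans hJ.1, hJ.2⟩, h⟩
    · refine ⟨⟨(I.fst, A), hIA⟩, ⟨le_rfl, hA⟩, ⟨hc.1, hcA⟩, ?_⟩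
      calc P.prob A ≤ P.prob I.fst + P.prob (E ⊓ I.snd) := P.prob_sup_le _ _
        _ ≤ P.prob I.fst + η := by grw [P.prob_mono inf_le_left, hE]

theorem HasSmallCovers.exists_antitone_interval (hP : P.HasSmallCovers)
    (I : NonemptyInterval (Event S)) {c : ℝ} (hc : c ∈ Set.Icc (P.prob I.fst) (P.prob I.snd)) :
    ∃ J : ℕ → NonemptyInterval (Event S), J 0 ≤ I ∧ Antitone J ∧
      ∀ n : ℕ, c ∈ Set.Icc (P.prob (J n).fst) (P.prob (J n).snd) ∧
        P.prob (J n).snd ≤ P.prob (J n).fst + 1 / ((n : ℝ) + 1) := by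
  have hstep (n : ℕ) (I : {I : NonemptyInterval (Event S) //
      c ∈ Set.Icc (P.prob I.fst) (P.prob I.snd)}) :
      ∃ J : {I : NonemptyInterval (Event S) // c ∈ Set.Icc (P.prob I.fst) (P.prob I.snd)},
        J ≤ I ∧ P.prob J.1.snd ≤ P.prob J.1.fst + 1 / ((n : ℝ) + 1) := by
    have hη : (0 : ℝ) < 1 / ((n : ℝ) + 1) := Nat.one_div_pos_of_nat
    obtain ⟨s, hs, hsη⟩ := hP _ hη
    obtain ⟨J, hJI, hJc, hJ⟩ := exists_interval_le_of_le_sup hη.le hsη I.1 (by simp [hs]) I.2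
    exact ⟨⟨J, hJc⟩, hJI, hJ⟩
  choose next hle hnext using hstep
  let J : ℕ → {I : NonemptyInterval (Event S) // c ∈ Set.Icc (P.prob I.fst) (P.prob I.snd)} :=
    Nat.rec ⟨I, hc⟩ next
  exact ⟨fun n => (J (n + 1)).1, hle 0 ⟨I, hc⟩,
    antitone_nat_of_succ_le fun n => hle (n + 1) (J (n + 1)),
    fun n => ⟨(J (n + 1)).2, hnext n (J n)⟩⟩

theorem exists_forall_mem_of_antitone {J : ℕ → NonemptyInterval (Event S)} (hJ : Antitone J) :
    ∃ F : Event S, ∀ n, F ∈ J n := by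
  refine ⟨⟨⋃ n, (J n).fst.1, @MeasurableSet.iUnion _ _ S.sigma _ _ fun n => (J n).fst.2⟩,
    fun n => ⟨Set.subset_iUnion (fun n => (J n).fst.1) n, Set.iUnion_subset fun m => ?_⟩⟩
  exact (hJ (le_max_left m n)).1.trans
    ((J (max m n)).fst_le_snd.trans (hJ (le_max_right m n)).2)

theorem HasSmallCovers.stronglyNonatomic (hP : P.HasSmallCovers) : P.StronglyNonatomic := by
  rintro E α ⟨hα₀, hα₁⟩
  obtain ⟨J, hJE, hanti, hJ⟩ := hP.exists_antitone_interval (c := α * P.prob E) ⟨(⊥, E), bot_le⟩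
    ⟨P.prob_bot.trans_le (mul_nonneg hα₀ (P.nonneg E)), mul_le_of_le_one_left (P.nonneg E) hα₁⟩
  obtain ⟨F, hF⟩ := exists_forall_mem_of_antitone hanti
  refine ⟨F, (hF 0).2.trans hJE.2, ?_⟩
  have hclose (n : ℕ) : |P.prob F - α * P.prob E| ≤ 1 / ((n : ℝ) + 1) := by
    obtain ⟨⟨hlo, hhi⟩, hlen⟩ := hJ n
    have hfst : P.prob (J n).fst ≤ P.prob F := P.prob_mono (hF n).1
    have hsnd : P.prob F ≤ P.prob (J n).snd := P.prob_mono (hF n).2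
    exact abs_sub_le_iff.2 ⟨by linarith, by linarith⟩
  have hlim : |P.prob F - α * P.prob E| ≤ 0 :=
    ge_of_tendsto' tendsto_one_div_add_atTop_nhds_zero_nat hclose
  exact sub_eq_zero.1 (abs_nonpos_iff.1 hlim)

/-- The finitely additive probability given by the values of a linear functional on indicators. -/
noncomputable def ofLinearMap (S : EventAlgebra) (g : ℓ^∞(Paths, ℝ) →ₗ[ℝ] ℝ) (hone : g 1 = 1)
    (hg : ∀ A : Set Paths, 0 ≤ g (boundedIndicator A)) : FinAddProb S where
  prob E := g (boundedIndicator E.1)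
  nonneg E := hg E.1
  prob_univ := by rw [boundedIndicator_univ, hone]
  prob_union E F h := by rw [boundedIndicator_union h, map_add]

end FinAddProb

section LastOne

/-- The path that follows `ω` before period `k`, has a `1` at `k`, and is `0` afterwards. -/
def truncate (ω : Paths) (k : ℕ) : Paths :=
  fun j => if j < k then ω j else if j = k then 1 else 0

theorem tendsto_truncate (ω : Paths) : Tendsto (truncate ω) atTop (𝓝 ω) := by
  refine tendsto_pi_nhds.2 fun j => tendsto_const_nhds.congr' ?_
  filter_upwards [eventually_gt_atTop j] with k hk
  simp [truncate, hk]

/-- The period of the last `1` of a path, with the junk value `0` if there is no last `1`. -/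
noncomputable def lastOne (ω : Paths) : ℕ := ⨆ j, j * (ω j : ℕ)

theorem measurable_lastOne : Measurable lastOne :=
  .iSup fun j => by fun_prop

theorem lastOne_truncate (ω : Paths) (k : ℕ) : lastOne (truncate ω k) = k := by
  have hle (j : ℕ) : j * (truncate ω k j : ℕ) ≤ k := by
    rcases lt_trichotomy j k with h | rfl | h
    · have hω : (ω j : ℕ) ≤ 1 := (ω j).is_le
      simp only [truncate, h, if_true]
      nlinarith
    · simp [truncate]
    · simp [truncate, h.not_gt, h.ne']
  refine le_antisymm (ciSup_le hle) (le_ciSup_of_le ⟨k, Set.forall_mem_range.2 hle⟩ k ?_)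
  simp [truncate]

theorem EventAlgebra.measurableSet_of_measurableSet (S : EventAlgebra) {A : Set Paths}
    (hA : MeasurableSet A) : MeasurableSet[S.sigma] A := by
  have hborel : borel Paths ≤ S.sigma :=
    MeasurableSpace.generateFrom_le fun _ => S.measurableSet_of_isOpen
  exact hborel _ (BorelSpace.measurable_eq (α := Paths) ▸ hA)

/-- The event that the last `1` of a path is at a period congruent to `r` modulo `n`. For
`r = 0, …, n - 1` these events are the small cover that makes a probability an opinion. -/
def residueEvent (S : EventAlgebra) (n r : ℕ) : Event S :=
  ⟨lastOne ⁻¹' {k | k ≡ r [MOD n]},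
    S.measurableSet_of_measurableSet (measurable_lastOne (.of_discrete))⟩

theorem sup_residueEvent (S : EventAlgebra) {n : ℕ} (hn : 0 < n) :
    (Finset.range n).sup (residueEvent S n) = ⊤ := by
  refine top_le_iff.1 fun ω _ => ?_
  have hmem : ω ∈ (residueEvent S n (lastOne ω % n)).1 := (Nat.mod_modEq _ _).symm
  have hle : residueEvent S n (lastOne ω % n) ≤ _ :=
    Finset.le_sup (f := residueEvent S n) (Finset.mem_range.2 (Nat.mod_lt (lastOne ω) hn))
  exact hle hmem

/-- The cone of bounded functions with partial sums bounded below along the truncations of every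
path. The normalised functionals that are nonnegative on it give rise to opinions. -/
noncomputable def truncationCone : PointedCone ℝ ℓ^∞(Paths, ℝ) :=
  ⨅ ω : Paths, partialSumCone (truncate ω)

theorem mem_truncationCone_of_nonneg {f : ℓ^∞(Paths, ℝ)} (hf : ∀ ω, 0 ≤ f ω) :
    f ∈ truncationCone :=
  Submodule.mem_iInf _ |>.2 fun _ =>
    mem_partialSumCone_of_eventually_nonneg (.of_forall fun _ => hf _)

theorem exists_smul_one_add_mem_truncationCone (f : ℓ^∞(Paths, ℝ)) :
    ∃ r : ℝ, r • (1 : ℓ^∞(Paths, ℝ)) + f ∈ truncationCone := by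
  refine ⟨‖f‖, mem_truncationCone_of_nonneg fun ω => ?_⟩
  have hf : -‖f‖ ≤ f ω := neg_le_of_abs_le (lp.norm_apply_le_norm ENNReal.top_ne_zero f ω)
  simp only [lp.coeFn_add, lp.coeFn_smul, lp.infty_coeFn_one, Pi.add_apply, Pi.smul_apply,
    Pi.one_apply, smul_eq_mul, mul_one]
  linarith

theorem inv_smul_one_sub_residueEvent_mem_truncationCone (S : EventAlgebra) {n : ℕ} (hn : 0 < n)
    (r : ℕ) :
    (n : ℝ)⁻¹ • (1 : ℓ^∞(Paths, ℝ)) - boundedIndicator (residueEvent S n r).1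
      ∈ truncationCone :=
  Submodule.mem_iInf _ |>.2 fun ω =>
    inv_smul_one_sub_boundedIndicator_mem_partialSumCone (r := r) hn fun k => by
      simp [residueEvent, lastOne_truncate]

end LastOne

section Opinions

theorem exists_opinion_of_linearMap (S : EventAlgebra) {g : ℓ^∞(Paths, ℝ) →ₗ[ℝ] ℝ}
    (hone : g 1 = 1) (hg : ∀ f ∈ truncationCone, 0 ≤ g f) :
    ∃ P : Opinion S, ∀ A : Event S, P.1.prob A = g (boundedIndicator A.1) := by
  classical
  let P : FinAddProb S := .ofLinearMap S g hone fun A => hg _ <|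
    mem_truncationCone_of_nonneg fun ω => Set.indicator_nonneg (fun _ _ => zero_le_one) ω
  refine ⟨⟨P, FinAddProb.HasSmallCovers.stronglyNonatomic fun η hη => ?_⟩, fun _ => rfl⟩
  obtain ⟨n, hn⟩ := exists_nat_one_div_lt hη
  refine ⟨(Finset.range (n + 1)).image (residueEvent S (n + 1)), ?_,
    Finset.forall_mem_image.2 fun r _ => ?_⟩
  · rw [Finset.sup_image]
    exact sup_residueEvent S n.succ_pos
  · have hr := hg _ (inv_smul_one_sub_residueEvent_mem_truncationCone S n.succ_pos r)
    rw [map_sub, map_smul, hone, smul_eq_mul, mul_one, sub_nonneg] at hr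
    refine hr.trans (le_of_eq_of_le ?_ hn.le)
    simp

theorem exists_opinion_forall_le_prob (S : EventAlgebra) {ι : Type*}
    (U : ι → TopologicalSpace.Opens Paths) {c : ℝ}
    (hU : ∀ w : ι →₀ ℝ≥0, ∃ ω,
      0 ≤ w.sum fun i a => (a : ℝ) * ((U i : Set Paths).indicator (1 : Paths → ℝ) ω - c)) :
    ∃ P : Opinion S, ∀ i, c ≤ P.1.prob (openEvent S (U i)) := by
  let v (i : ι) : ℓ^∞(Paths, ℝ) := boundedIndicator (U i : Set Paths) - c • 1
  let K : PointedCone ℝ ℓ^∞(Paths, ℝ) := truncationCone ⊔ .hull ℝ (Set.range v)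
  have hK (a : ℝ) (ha : a • (1 : ℓ^∞(Paths, ℝ)) ∈ K) : 0 ≤ a := by
    obtain ⟨f, hf, z, hz, hfz⟩ := Submodule.mem_sup.1 ha
    obtain ⟨w, rfl⟩ := Finsupp.mem_span_range_iff_exists_finsupp.1 hz
    obtain ⟨ω, hω⟩ := hU w
    refine nonneg_of_smul_one_mem_partialSumCone (x := truncate ω) ?_
    rw [← hfz]
    exact add_mem (Submodule.mem_iInf _ |>.1 hf ω)
      (sum_boundedIndicator_sub_mem_partialSumCone (tendsto_truncate ω) hω)
  obtain ⟨g, hone, hg⟩ := exists_linearMap_nonneg_of_orderUnit K 1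
    (fun f => (exists_smul_one_add_mem_truncationCone f).imp fun _ h => Submodule.mem_sup_left h) hK
  obtain ⟨P, hP⟩ := exists_opinion_of_linearMap S hone fun f hf => hg f (Submodule.mem_sup_left hf)
  refine ⟨P, fun i => ?_⟩
  have hi : 0 ≤ g (v i) := hg _ (Submodule.mem_sup_right (Submodule.subset_span ⟨i, rfl⟩))
  rw [map_sub, map_smul, hone, smul_eq_mul, mul_one, sub_nonneg] at hi
  exact hi.trans_eq (hP (openEvent S (U i))).symm

end Opinions

section FiniteStrategies

variable {X : Type*}

theorem toReal_toOuterMeasure_eq_sum (p : PMF X) {s : Finset X} (hs : p.support ⊆ s) (A : Set X) :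
    (p.toOuterMeasure A).toReal = ∑ x ∈ s, (p x).toReal * A.indicator (1 : X → ℝ) x := by
  have hp : ∀ x ∉ s, A.indicator p x = 0 := fun x hx =>
    Set.indicator_apply_eq_zero.2 fun _ => (p.apply_eq_zero_iff x).2 fun h => hx (hs h)
  rw [PMF.toOuterMeasure_apply, tsum_eq_sum hp, ENNReal.toReal_sum fun x _ => by
    by_cases hx : x ∈ A <;> simp [hx, p.apply_ne_top]]
  refine Finset.sum_congr rfl fun x _ => ?_
  by_cases hx : x ∈ A <;> simp [hx]

theorem exists_pmf_mul_sum_eq_sum_indicator {w : X →₀ ℝ≥0} (hw : w ≠ 0) :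
    ∃ p : PMF X, p.support.Finite ∧ ∀ A : Set X,
      (p.toOuterMeasure A).toReal * w.sum (fun _ a => (a : ℝ))
        = w.sum fun x a => (a : ℝ) * A.indicator (1 : X → ℝ) x := by
  have htsum : ∑' x, (w x : ℝ≥0∞) = ((∑ x ∈ w.support, w x : ℝ≥0) : ℝ≥0∞) := by
    rw [tsum_eq_sum (s := w.support) (by simp), ENNReal.ofNNReal_finsetSum]
  have hne : ∑ x ∈ w.support, w x ≠ 0 := by
    simpa [Finsupp.ext_iff] using hw
  let p : PMF X := .normalize (fun x => w x) (by simpa [htsum] using hne) (by simp [htsum])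
  have hp (x : X) : (p x).toReal * w.sum (fun _ a => (a : ℝ)) = w x := by
    rw [PMF.normalize_apply, htsum, ENNReal.toReal_mul, ENNReal.toReal_inv, ENNReal.coe_toReal,
      ENNReal.coe_toReal, NNReal.coe_sum]
    exact inv_mul_cancel_right₀ (by exact_mod_cast hne) _
  have hsupport : p.support ⊆ w.support := by
    rw [PMF.support_normalize]
    intro x hx
    simpa using hx
  refine ⟨p, w.support.finite_toSet.subset hsupport, fun A => ?_⟩
  rw [toReal_toOuterMeasure_eq_sum p hsupport, Finset.sum_mul]
  exact Finset.sum_congr rfl fun x _ => by rw [mul_right_comm, hp]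

theorem exists_nonneg_sum_of_not_canBeManipulated {S : EventAlgebra} {T : Test S} {c : ℝ}
    (hT : ¬T.CanBeManipulated (1 - c)) (w : Opinion S →₀ ℝ≥0) :
    ∃ ω, 0 ≤ w.sum fun P a => (a : ℝ) * ((T P : Set Paths).indicator (1 : Paths → ℝ) ω - c) := by
  rcases eq_or_ne w 0 with rfl | hw
  · exact ⟨0, by simp⟩
  obtain ⟨p, hfin, hp⟩ := exists_pmf_mul_sum_eq_sum_indicator hw
  simp only [Test.CanBeManipulated, not_exists, not_forall, not_le] at hT
  obtain ⟨ω, hω⟩ := hT ⟨p, hfin⟩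
  refine ⟨ω, ?_⟩
  have hcompl : w.sum (fun P a => (a : ℝ) * {P | ω ∉ T P}.indicator (1 : Opinion S → ℝ) P)
      = w.sum (fun _ a => (a : ℝ))
        - w.sum fun P a => (a : ℝ) * (T P : Set Paths).indicator (1 : Paths → ℝ) ω := by
    rw [← Finsupp.sum_sub]
    refine Finsupp.sum_congr fun P _ => ?_
    by_cases h : ω ∈ T P <;> simp [h]
  have hsum : 0 ≤ w.sum fun _ a => (a : ℝ) := Finset.sum_nonneg fun P _ => (w P).2
  have hle := mul_le_mul_of_nonneg_right hω.le hsum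
  rw [Strategy.probOf, hp, hcompl] at hle
  simp only [mul_sub, Finsupp.sum_sub]
  rw [← Finsupp.sum_mul]
  linarith

end FiniteStrategies

end OpinionTesting

theorem theorem2 (S : OpinionTesting.EventAlgebra) (ε : ℝ) (hε₀ : 0 ≤ ε) (hε₁ : ε < 1)
    (T : OpinionTesting.Test S)
    (hT : OpinionTesting.Test.ControlsTypeI T Set.univ ε)
    (δ : ℝ) (hδ : δ ∈ Set.Ioc (0 : ℝ) (1 - ε)) :
    OpinionTesting.Test.CanBeManipulated T (1 - ε - δ) := by
  rw [sub_sub]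
  by_contra hmanip
  obtain ⟨P, hP⟩ := OpinionTesting.exists_opinion_forall_le_prob S T
    (OpinionTesting.exists_nonneg_sum_of_not_canBeManipulated hmanip)
  linarith [hP P, hT P trivial, hδ.1]
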